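/- **Setting.** Let $\mathbb{Y}$ be a finite non-empty set of labels and let $D$ be a probability distribution on $\mathbb{R}^d\times\mathbb{Y}$ with joint density $g_c(x)=p(x,\mathbf{y}=c)$. Assume that every $g_c$ is twice continuously differentiable with integrable second derivative, $\int\|D^2 g_c(x)\|\,dx<\infty$, and that the marginal density $p(x)=\sum_c g_c(x)$ satisfies $\int\sqrt{p(x)}\,dx<\infty$ (for example, $p$ has compact support). Let $K:\mathbb{R}^d\to[0,\infty)$ be measurable, bounded and even, with $\int K(u)\,du=1$ and $\int\|u\|^2K(u)\,du<\infty$, and for a bandwidth $\sigma>0$ put $s_\sigma(x,x')=\sigma^{-d}K((x-x')/\sigma)$. For an i.i.d. sample $(x_1,y_1),\dots,(x_n,y_n)\sim D$ let $$\hat p_D(\mathbf{y}=c\mid \mathbf{x}=x_i)=\frac{\sum_{j\ne i}[y_j=c]\,s_\sigma(x_j,x_i)}{\sum_{k\neq i}s_\sigma(x_k,x_i)}\quad(\text{with } 0/0=0),\qquad \hat\beta_D=1-\frac1n\sum_{i=1}^n\max_{c}\hat p_D(\mathbf{y}=c\mid\mathbf{x}=x_i),$$ and let $\beta_D=\operatorname{E}_{\mathbf{x}}[1-\max_c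 p(\mathbf{y}=c\mid\mathbf{x})]$ be the Bayes error of $D$. **Theorem.** There are constants $C_1,C_2>0$, depending only on $D$ and $K$, such that for all $n\ge1$ and all $\sigma>0$, $$\operatorname{E}\bigl|\hat p_D(\mathbf{y}=c\mid\mathbf{x}=x_i)-p(\mathbf{y}=c\mid\mathbf{x}=x_i)\bigr|\le C_2\sigma^2+\frac{C_1}{\sqrt{n\sigma^d}}\qquad\text{for every } i\in\{1,\dots,n\},\ c\in\mathbb{Y},$$ and $$\operatorname{E}\bigl|\hat\beta_D-\beta_D\bigr|\le 2C_2|\mathbb{Y}|\sigma^2+\frac{2C_1|\mathbb{Y}|}{\sqrt{n\sigma^d}},$$ where the expectations are over the sample. -/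

import Mathlib

open MeasureTheory

noncomputable section

namespace BayesError

/-- Output of local posterior averaging on the sample `z = ((x₁,y₁),…,(xₙ,yₙ))` with similarity `s`:
the leave-one-out estimate of the posterior probability of the class `c` at the sample point `xᵢ`,
`(∑_{j ≠ i} [yⱼ = c] s(xⱼ,xᵢ)) / (∑_{k ≠ i} s(xₖ,xᵢ))`, with the convention `0 / 0 = 0`. -/
def posteriorEstimate {X Y : Type*} [DecidableEq Y] (s : X → X → ℝ) {n : ℕ}
    (z : Fin n → X × Y) (i : Fin n) (c : Y) : ℝ :=
  (∑ j ∈ Finset.univ.erase i, (if (z j).2 = c then 1 else 0) * s (z j).1 (z i).1) /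
    ∑ k ∈ Finset.univ.erase i, s (z k).1 (z i).1

/-- The plug-in Bayes error estimate `1 - (1/n) ∑ᵢ max_c p̂(c | xᵢ)`. -/
def bayesErrorEstimate {X Y : Type*} [DecidableEq Y] (s : X → X → ℝ) {n : ℕ}
    (z : Fin n → X × Y) : ℝ :=
  1 - (1 / (n : ℝ)) * ∑ i, ⨆ c, posteriorEstimate s z i c

/-- The true posterior probability `p(y = c | x)`: the regular conditional probability of the
label given the feature. -/
def posterior {X Y : Type*} [MeasurableSpace X] [MeasurableSpace Y] [StandardBorelSpace Y]
    [Nonempty Y] (D : Measure (X × Y)) [IsFiniteMeasure D] (x : X) (c : Y) : ℝ :=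
  (D.condKernel x).real {c}

/-- The Bayes error `E_x [1 - max_c p(y = c | x)]`, with `x` distributed as the first marginal
of `D`. -/
def bayesError {X Y : Type*} [MeasurableSpace X] [MeasurableSpace Y] [StandardBorelSpace Y]
    [Nonempty Y] (D : Measure (X × Y)) [IsFiniteMeasure D] : ℝ :=
  ∫ x, (1 - ⨆ c, posterior D x c) ∂D.fst

/-- A smoothing kernel on `ℝᵈ`: nonnegative, even, bounded, of integral one (hence integrable), with
finite second moment. -/
structure IsSmoothingKernel {d : ℕ} (K : EuclideanSpace ℝ (Fin d) → ℝ) : Prop where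
  measurable : Measurable K
  nonneg : ∀ u, 0 ≤ K u
  even : ∀ u, K (-u) = K u
  bounded : ∃ κ : ℝ, ∀ u, K u ≤ κ
  integral_eq_one : ∫ u, K u = 1
  second_moment : Integrable (fun u => ‖u‖ ^ 2 * K u)

/-- The similarity function `s(x, x') = σ⁻ᵈ K((x - x') / σ)` of bandwidth `σ`. -/
def similarity {d : ℕ} (K : EuclideanSpace ℝ (Fin d) → ℝ) (σ : ℝ)
    (x x' : EuclideanSpace ℝ (Fin d)) : ℝ :=
  (σ ^ d)⁻¹ * K (σ⁻¹ • (x - x'))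

/-- `g c` is the joint density `p(x, y = c)` (Lebesgue in `x`, counting in `c`) of `D`, and it has
the regularity of the second order analysis of kernel regression: it is twice continuously
differentiable with integrable second derivative, and the square root of the marginal
density `∑ c, g c` is integrable. -/
structure IsRegularDensity {d : ℕ} {Y : Type*} [Fintype Y] [MeasurableSpace Y]
    (D : Measure (EuclideanSpace ℝ (Fin d) × Y)) (g : Y → EuclideanSpace ℝ (Fin d) → ℝ) :
    Prop where
  nonneg : ∀ c x, 0 ≤ g c x
  density : ∀ c (A : Set (EuclideanSpace ℝ (Fin d))), MeasurableSet A →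
    D (A ×ˢ {c}) = ∫⁻ x in A, ENNReal.ofReal (g c x)
  contDiff : ∀ c, ContDiff ℝ 2 (g c)
  integrable_hessian : ∀ c, Integrable (iteratedFDeriv ℝ 2 (g c))
  integrable_sqrt : Integrable (fun x => √(∑ c, g c x))

end BayesError

end

/-!
Given the query point `x`, numerator and denominator of the estimate are averages of independent
copies of `[y = c] s(x', x)` and `s(x', x)`, whose means are the smoothed densities
`K_σ ⋆ g_c` and `K_σ ⋆ p`. As the ratio is at most `1`, multiplying its error by `p(x)` removes the
division: `p |N / S - g_c / p| ≤ |N - g_c| + |S - p|`.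

The bias is of second order because `K` is even: `2 (K_σ ⋆ g - g)(x)` is the `K_σ`-average of the
second differences `g(x + u) + g(x - u) - 2 g(x)`, whose `L¹` norm in `x` is at most
`2 ‖u‖² ∫ ‖D²g‖`.

For the fluctuation, `0 ≤ s ≤ b` bounds the variances by `b` times the mean of `s`. Either this mean
is at most `2 p(x)`, which gives a fluctuation of order `√(b p(x) / n)`, integrable in `x` by the
hypothesis on `√p`; or `p(x)` is smaller than the bias of the denominator, and bounding the error of
the estimate by `1` costs no more than that bias.

For the Bayes error, `max_c` changes by at most the sum of the coordinate errors, and replacing the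
sample average of the true `max_c p(c | xᵢ)` by its mean costs `1 / √n`. Taking `C₁, C₂ ≥ 1` makes
this at most the rate, since either `σ ≤ 1` or `σ² ≥ 1`.
-/

noncomputable section

namespace BayesError

section SecondDifference

variable {E F : Type*} [NormedAddCommGroup E] [NormedSpace ℝ E] [NormedAddCommGroup F]
  [NormedSpace ℝ F] [CompleteSpace F]

theorem norm_secondDifference_le_integral {f f' f'' : ℝ → F} (hf : ∀ t, HasDerivAt f (f' t) t)
    (hf' : ∀ t, HasDerivAt f' (f'' t) t) (hc : Continuous f'') :
    ‖f 1 + f (-1) - (2 : ℝ) • f 0‖ ≤ ∫ t in (-1 : ℝ)..1, ‖f'' t‖ := by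
  have hsymm : ∀ t, HasDerivAt (fun t => f t + f (-t)) (f' t - f' (-t)) t := fun t => by
    simpa [sub_eq_add_neg] using (hf t).fun_add ((hf (-t)).scomp t (hasDerivAt_neg t))
  have hbound : ∀ t ∈ Set.Ico (0 : ℝ) 1, ‖f' t - f' (-t)‖ ≤ ∫ r in (-1 : ℝ)..1, ‖f'' r‖ := by
    rintro t ⟨ht0, ht1⟩
    rw [← intervalIntegral.integral_eq_sub_of_hasDerivAt (fun r _ => hf' r)
      (hc.intervalIntegrable _ _)]
    calc ‖∫ r in (-t)..t, f'' r‖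
      _ ≤ ∫ r in (-t)..t, ‖f'' r‖ := intervalIntegral.norm_integral_le_integral_norm (by linarith)
      _ ≤ ∫ r in (-1 : ℝ)..1, ‖f'' r‖ :=
        intervalIntegral.integral_mono_interval (by linarith) (by linarith) ht1.le
          (.of_forall fun _ => norm_nonneg _) (hc.norm.intervalIntegrable _ _)
  have hvalue : f 1 + f (-1) - (2 : ℝ) • f 0 = (f 1 + f (-1)) - (f 0 + f (-0)) := by
    rw [neg_zero, two_smul]
  rw [hvalue]
  exact norm_image_sub_le_of_norm_deriv_le_segment_01' (fun t _ => (hsymm t).hasDerivWithinAt)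
    hbound

theorem norm_add_sub_two_smul_le_integral {g : E → F} (hg : ContDiff ℝ 2 g) (x v : E) :
    ‖g (x + v) + g (x - v) - (2 : ℝ) • g x‖ ≤
      ∫ t in (-1 : ℝ)..1, ‖iteratedFDeriv ℝ 2 g (x + t • v)‖ * ‖v‖ ^ 2 := by
  have hg' : ContDiff ℝ 1 (fderiv ℝ g) := hg.fderiv_right (by norm_num)
  have hline : ∀ t : ℝ, HasDerivAt (fun t : ℝ => x + t • v) v t := fun t => by
    simpa using ((hasDerivAt_id t).smul_const v).const_add x
  have hderiv : ∀ t : ℝ, HasDerivAt (fun t : ℝ => g (x + t • v)) (fderiv ℝ g (x + t • v) v) t :=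
    fun t => (hg.differentiable (by norm_num) _).hasFDerivAt.comp_hasDerivAt t (hline t)
  have hderiv' : ∀ t : ℝ, HasDerivAt (fun t : ℝ => fderiv ℝ g (x + t • v) v)
      (fderiv ℝ (fderiv ℝ g) (x + t • v) v v) t := fun t => by
    have := (hg'.differentiable (by norm_num) _).hasFDerivAt.comp_hasDerivAt t (hline t)
    simpa using this.clm_apply (hasDerivAt_const t v)
  have hcont : Continuous fun t : ℝ => fderiv ℝ (fderiv ℝ g) (x + t • v) v v := by
    have := hg'.continuous_fderiv (by norm_num)
    fun_prop
  have hcont' : Continuous fun t : ℝ => ‖iteratedFDeriv ℝ 2 g (x + t • v)‖ * ‖v‖ ^ 2 := by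
    have := hg.continuous_iteratedFDeriv (m := 2) le_rfl
    fun_prop
  calc ‖g (x + v) + g (x - v) - (2 : ℝ) • g x‖
    _ ≤ ∫ t in (-1 : ℝ)..1, ‖fderiv ℝ (fderiv ℝ g) (x + t • v) v v‖ := by
      simpa [← sub_eq_add_neg] using norm_secondDifference_le_integral hderiv hderiv' hcont
    _ ≤ ∫ t in (-1 : ℝ)..1, ‖iteratedFDeriv ℝ 2 g (x + t • v)‖ * ‖v‖ ^ 2 := by
      refine intervalIntegral.integral_mono_on (by norm_num) (hcont.norm.intervalIntegrable _ _)
        (hcont'.intervalIntegrable _ _) fun t _ => ?_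
      simpa [iteratedFDeriv_two_apply, pow_two] using
        (iteratedFDeriv ℝ 2 g (x + t • v)).le_opNorm ![v, v]

theorem enorm_add_sub_two_smul_le_lintegral {g : E → F} (hg : ContDiff ℝ 2 g) (x v : E) :
    ‖g (x + v) + g (x - v) - (2 : ℝ) • g x‖ₑ ≤
      ∫⁻ t in Set.Ioc (-1 : ℝ) 1, ‖iteratedFDeriv ℝ 2 g (x + t • v)‖ₑ * ‖v‖ₑ ^ 2 := by
  have hle := norm_add_sub_two_smul_le_integral hg x v
  rw [intervalIntegral.integral_of_le (by norm_num)] at hle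
  refine (enorm_le_iff_norm_le.2 (hle.trans (Real.le_norm_self _))).trans
    ((enorm_integral_le_lintegral_enorm _).trans_eq (lintegral_congr fun t => ?_))
  rw [enorm_mul, enorm_pow, enorm_norm, enorm_norm]

variable [MeasurableSpace E] [BorelSpace E] [FiniteDimensional ℝ E]

theorem lintegral_enorm_add_sub_two_smul_le (μ : Measure E) [μ.IsAddHaarMeasure] {g : E → F}
    (hg : ContDiff ℝ 2 g) (v : E) :
    ∫⁻ x, ‖g (x + v) + g (x - v) - (2 : ℝ) • g x‖ₑ ∂μ ≤
      2 * (‖v‖ₑ ^ 2 * ∫⁻ x, ‖iteratedFDeriv ℝ 2 g x‖ₑ ∂μ) := by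
  have hmeas : Measurable fun x => ‖iteratedFDeriv ℝ 2 g x‖ₑ :=
    (hg.continuous_iteratedFDeriv (m := 2) le_rfl).enorm.measurable
  have hjoint : Measurable fun q : E × ℝ =>
      ‖iteratedFDeriv ℝ 2 g (q.1 + q.2 • v)‖ₑ * ‖v‖ₑ ^ 2 :=
    (hmeas.comp (by fun_prop)).mul_const _
  calc ∫⁻ x, ‖g (x + v) + g (x - v) - (2 : ℝ) • g x‖ₑ ∂μ
    _ ≤ ∫⁻ x, (∫⁻ t in Set.Ioc (-1 : ℝ) 1, ‖iteratedFDeriv ℝ 2 g (x + t • v)‖ₑ * ‖v‖ₑ ^ 2) ∂μ :=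
      lintegral_mono fun x => enorm_add_sub_two_smul_le_lintegral hg x v
    _ = ∫⁻ t in Set.Ioc (-1 : ℝ) 1, ∫⁻ x, ‖iteratedFDeriv ℝ 2 g (x + t • v)‖ₑ * ‖v‖ₑ ^ 2 ∂μ :=
      lintegral_lintegral_swap hjoint.aemeasurable
    _ = ∫⁻ _ in Set.Ioc (-1 : ℝ) 1, ‖v‖ₑ ^ 2 * ∫⁻ x, ‖iteratedFDeriv ℝ 2 g x‖ₑ ∂μ := by
      refine lintegral_congr fun t => ?_
      rw [lintegral_mul_const' _ _ (by finiteness), mul_comm,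
        lintegral_add_right_eq_self (fun x => ‖iteratedFDeriv ℝ 2 g x‖ₑ)]
    _ = 2 * (‖v‖ₑ ^ 2 * ∫⁻ x, ‖iteratedFDeriv ℝ 2 g x‖ₑ ∂μ) := by
      rw [setLIntegral_const, Real.volume_Ioc, mul_comm]
      norm_num

end SecondDifference

section Convolution

open scoped Convolution
open ContinuousLinearMap (lsmul)

variable {E F : Type*} [NormedAddCommGroup E] [NormedSpace ℝ E] [FiniteDimensional ℝ E]
  [MeasurableSpace E] [BorelSpace E] {μ : Measure E} [μ.IsAddHaarMeasure]
  [NormedAddCommGroup F] [NormedSpace ℝ F] [CompleteSpace F] {K : E → ℝ} {g : E → F}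

theorem convolution_sub_eq_integral_secondDifference (hK : Integrable K μ) (heven : K.Even)
    (hK1 : ∫ u, K u ∂μ = 1) {x : E} (hx : ConvolutionExistsAt K g x (lsmul ℝ ℝ) μ) :
    (K ⋆[lsmul ℝ ℝ, μ] g) x - g x =
      (2⁻¹ : ℝ) • ∫ u, K u • (g (x + u) + g (x - u) - (2 : ℝ) • g x) ∂μ := by
  have hminus : Integrable (fun u => K u • g (x - u)) μ := hx
  have hplus : Integrable (fun u => K u • g (x + u)) μ := by
    simpa [heven _] using hminus.comp_neg
  have hconst : ∫ u, K u • (2 : ℝ) • g x ∂μ = (2 : ℝ) • g x := by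
    rw [integral_smul_const, hK1, one_smul]
  have hreflect : ∫ u, K u • g (x + u) ∂μ = ∫ u, K u • g (x - u) ∂μ := by
    rw [← integral_neg_eq_self]
    simp [heven _, sub_eq_add_neg]
  simp_rw [smul_sub, smul_add]
  rw [integral_sub (hplus.fun_add hminus) (hK.smul_const _), integral_add hplus hminus, hconst,
    hreflect, ← two_smul ℝ, ← smul_sub, inv_smul_smul₀ two_ne_zero, convolution_lsmul]

theorem lintegral_enorm_convolution_sub_le (hK : Integrable K μ) (heven : K.Even)
    (hK1 : ∫ u, K u ∂μ = 1) (hg : Integrable g μ) (hg2 : ContDiff ℝ 2 g) :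
    ∫⁻ x, ‖(K ⋆[lsmul ℝ ℝ, μ] g) x - g x‖ₑ ∂μ ≤
      (∫⁻ u, ‖u‖ₑ ^ 2 * ‖K u‖ₑ ∂μ) * ∫⁻ x, ‖iteratedFDeriv ℝ 2 g x‖ₑ ∂μ := by
  have hpointwise : ∀ᵐ x ∂μ, ‖(K ⋆[lsmul ℝ ℝ, μ] g) x - g x‖ₑ ≤
      2⁻¹ * ∫⁻ u, ‖K u‖ₑ * ‖g (x + u) + g (x - u) - (2 : ℝ) • g x‖ₑ ∂μ := by
    filter_upwards [hK.ae_convolution_exists (lsmul ℝ ℝ) hg] with x hx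
    rw [convolution_sub_eq_integral_secondDifference hK heven hK1 hx, enorm_smul,
      show ‖(2⁻¹ : ℝ)‖ₑ = 2⁻¹ by simp [enorm_inv, Real.enorm_eq_ofReal]]
    gcongr
    simpa only [enorm_smul] using enorm_integral_le_lintegral_enorm
      fun u => K u • (g (x + u) + g (x - u) - (2 : ℝ) • g x)
  have hcont : Continuous g := hg2.continuous
  have hjoint : AEMeasurable (fun q : E × E =>
      ‖K q.2‖ₑ * ‖g (q.1 + q.2) + g (q.1 - q.2) - (2 : ℝ) • g q.1‖ₑ) (μ.prod μ) :=
    hK.aestronglyMeasurable.comp_snd.enorm.mul (by fun_prop : Continuous fun q : E × E =>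
      g (q.1 + q.2) + g (q.1 - q.2) - (2 : ℝ) • g q.1).enorm.aemeasurable
  calc ∫⁻ x, ‖(K ⋆[lsmul ℝ ℝ, μ] g) x - g x‖ₑ ∂μ
    _ ≤ ∫⁻ x, 2⁻¹ * ∫⁻ u, ‖K u‖ₑ * ‖g (x + u) + g (x - u) - (2 : ℝ) • g x‖ₑ ∂μ ∂μ :=
      lintegral_mono_ae hpointwise
    _ = 2⁻¹ * ∫⁻ u, ‖K u‖ₑ * ∫⁻ x, ‖g (x + u) + g (x - u) - (2 : ℝ) • g x‖ₑ ∂μ ∂μ := by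
      rw [lintegral_const_mul' _ _ (by simp), lintegral_lintegral_swap hjoint]
      simp_rw [lintegral_const_mul' _ _ enorm_ne_top]
    _ ≤ 2⁻¹ * ∫⁻ u, 2 * (‖u‖ₑ ^ 2 * ‖K u‖ₑ * ∫⁻ x, ‖iteratedFDeriv ℝ 2 g x‖ₑ ∂μ) ∂μ := by
      refine mul_le_mul_right (lintegral_mono fun u => ?_) _
      calc ‖K u‖ₑ * ∫⁻ x, ‖g (x + u) + g (x - u) - (2 : ℝ) • g x‖ₑ ∂μ
        _ ≤ ‖K u‖ₑ * (2 * (‖u‖ₑ ^ 2 * ∫⁻ x, ‖iteratedFDeriv ℝ 2 g x‖ₑ ∂μ)) := by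
          gcongr
          exact lintegral_enorm_add_sub_two_smul_le μ hg2 u
        _ = 2 * (‖u‖ₑ ^ 2 * ‖K u‖ₑ * ∫⁻ x, ‖iteratedFDeriv ℝ 2 g x‖ₑ ∂μ) := by ring
    _ = (∫⁻ u, ‖u‖ₑ ^ 2 * ‖K u‖ₑ ∂μ) * ∫⁻ x, ‖iteratedFDeriv ℝ 2 g x‖ₑ ∂μ := by
      rw [lintegral_const_mul' _ _ (by simp), ← mul_assoc,
        ENNReal.inv_mul_cancel (by simp) (by simp), one_mul, lintegral_mul_const'']
      exact (measurable_enorm.pow_const 2).aemeasurable.mul hK.aestronglyMeasurable.enorm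

theorem integral_norm_convolution_sub_le (hK : Integrable K μ) (heven : K.Even)
    (hK1 : ∫ u, K u ∂μ = 1) (hK2 : Integrable (fun u => ‖u‖ ^ 2 * ‖K u‖) μ)
    (hg : Integrable g μ) (hg2 : ContDiff ℝ 2 g) (hgH : Integrable (iteratedFDeriv ℝ 2 g) μ) :
    ∫ x, ‖(K ⋆[lsmul ℝ ℝ, μ] g) x - g x‖ ∂μ ≤
      (∫ u, ‖u‖ ^ 2 * ‖K u‖ ∂μ) * ∫ x, ‖iteratedFDeriv ℝ 2 g x‖ ∂μ := by
  have hsub : Integrable (fun x => (K ⋆[lsmul ℝ ℝ, μ] g) x - g x) μ :=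
    (hK.integrable_convolution (lsmul ℝ ℝ) hg).sub hg
  have hmoment : ENNReal.ofReal (∫ u, ‖u‖ ^ 2 * ‖K u‖ ∂μ) = ∫⁻ u, ‖u‖ₑ ^ 2 * ‖K u‖ₑ ∂μ := by
    rw [ofReal_integral_eq_lintegral_ofReal hK2 (.of_forall fun u => by positivity)]
    simp_rw [ENNReal.ofReal_mul (sq_nonneg _), ENNReal.ofReal_pow (norm_nonneg _), ofReal_norm]
  rw [← ENNReal.ofReal_le_ofReal_iff (by positivity), ENNReal.ofReal_mul (by positivity), hmoment,
    ofReal_integral_norm_eq_lintegral_enorm hsub, ofReal_integral_norm_eq_lintegral_enorm hgH]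
  exact lintegral_enorm_convolution_sub_le hK heven hK1 hg hg2

end Convolution

section Average

open ProbabilityTheory

theorem integral_abs_sub_integral_le_sqrt_variance {Ω : Type*} [MeasurableSpace Ω] {P : Measure Ω}
    [IsProbabilityMeasure P] {f : Ω → ℝ} (hf : MemLp f 2 P) :
    ∫ ω, |f ω - ∫ ω', f ω' ∂P| ∂P ≤ √Var[f; P] := by
  have hdev : MemLp (fun ω => |f ω - ∫ ω', f ω' ∂P|) 2 P := (hf.sub (memLp_const _)).abs
  have hnonneg := variance_nonneg (fun ω => |f ω - ∫ ω', f ω' ∂P|) P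
  rw [variance_eq_sub hdev] at hnonneg
  refine Real.le_sqrt_of_sq_le ?_
  rw [variance_eq_integral hf.aemeasurable]
  simpa using hnonneg

variable {ι Z : Type*} [Fintype ι] [MeasurableSpace Z] {D : Measure Z} [IsProbabilityMeasure D]
  {f : Z → ℝ}

theorem memLp_comp_eval {p : ENNReal} (hf : MemLp f p D) (j : ι) :
    MemLp (fun w : ι → Z => f (w j)) p (Measure.pi fun _ => D) :=
  hf.comp_measurePreserving (measurePreserving_eval (fun _ : ι => D) j)

theorem memLp_average {p : ENNReal} (hf : MemLp f p D) :
    MemLp (fun w : ι → Z => (∑ j, f (w j)) / Fintype.card ι) p (Measure.pi fun _ => D) := by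
  simp_rw [div_eq_inv_mul]
  exact (memLp_finsetSum _ fun j _ => memLp_comp_eval hf j).const_mul _

theorem integral_average [Nonempty ι] (hf : Integrable f D) :
    ∫ w : ι → Z, (∑ j, f (w j)) / Fintype.card ι ∂(Measure.pi fun _ => D) = ∫ z, f z ∂D := by
  have heval : ∀ j : ι, ∫ w : ι → Z, f (w j) ∂(Measure.pi fun _ => D) = ∫ z, f z ∂D := fun j =>
    integral_comp_eval (μ := fun _ : ι => D) hf.aestronglyMeasurable
  rw [integral_div, integral_finsetSum _ fun j _ =>
    memLp_one_iff_integrable.1 (memLp_comp_eval (memLp_one_iff_integrable.2 hf) j)]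
  simp [heval]

theorem variance_average (hf : MemLp f 2 D) :
    Var[fun w : ι → Z => (∑ j, f (w j)) / Fintype.card ι; Measure.pi fun _ => D] =
      Var[f; D] / Fintype.card ι := by
  have hsum : Var[fun w : ι → Z => ∑ j, f (w j); Measure.pi fun _ => D] =
      Fintype.card ι * Var[f; D] := by
    simpa [← Finset.sum_fn] using variance_sum_pi (μ := fun _ : ι => D) (X := fun _ => f)
      fun _ => hf
  simp_rw [div_eq_inv_mul, variance_const_mul, hsum]
  rcases eq_or_ne (Fintype.card ι : ℝ) 0 with h | h
  · simp [h]
  · field_simp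

theorem integral_abs_average_sub_le [Nonempty ι] (hf : MemLp f 2 D) :
    ∫ w : ι → Z, |(∑ j, f (w j)) / Fintype.card ι - ∫ z, f z ∂D| ∂(Measure.pi fun _ => D) ≤
      √(Var[f; D] / Fintype.card ι) := by
  have h := integral_abs_sub_integral_le_sqrt_variance (memLp_average (ι := ι) hf)
  rwa [integral_average (hf.integrable one_le_two), variance_average hf] at h

theorem variance_le_mul_integral {b : ℝ} (hf : AEMeasurable f D) (hfb : ∀ z, f z ∈ Set.Icc 0 b) :
    Var[f; D] ≤ b * ∫ z, f z ∂D := by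
  have h := variance_le_sub_mul_sub (.of_forall hfb) hf
  nlinarith [sq_nonneg (∫ z, f z ∂D)]

theorem integral_abs_average_sub_le_sqrt_mul_integral [Nonempty ι] {b : ℝ} (hf : Measurable f)
    (hfb : ∀ z, f z ∈ Set.Icc 0 b) :
    ∫ w : ι → Z, |(∑ j, f (w j)) / Fintype.card ι - ∫ z, f z ∂D| ∂(Measure.pi fun _ => D) ≤
      √(b * (∫ z, f z ∂D) / Fintype.card ι) := by
  refine (integral_abs_average_sub_le
    (memLp_of_bounded (.of_forall hfb) hf.aestronglyMeasurable 2)).trans (Real.sqrt_le_sqrt ?_)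
  gcongr
  exact variance_le_mul_integral hf.aemeasurable hfb

theorem integrable_abs_average_sub (hf : Integrable f D) (e : ℝ) :
    Integrable (fun w : ι → Z => |(∑ j, f (w j)) / Fintype.card ι - e|)
      (Measure.pi fun _ => D) :=
  ((memLp_one_iff_integrable.1 (memLp_average (memLp_one_iff_integrable.2 hf))).sub
    (integrable_const e)).abs

theorem integral_pi_removeNth {m : ℕ} (i : Fin (m + 1)) {F : Z → (Fin m → Z) → ℝ}
    (hF : Integrable (Function.uncurry F) (D.prod (Measure.pi fun _ => D))) :
    ∫ z : Fin (m + 1) → Z, F (z i) (i.removeNth z) ∂(Measure.pi fun _ => D) =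
      ∫ a, ∫ w, F a w ∂(Measure.pi fun _ => D) ∂D :=
  ((measurePreserving_piFinSuccAbove (fun _ : Fin (m + 1) => D) i).integral_comp'
    (Function.uncurry F)).trans (integral_prod _ hF)

end Average

section LabelFrequency

variable {X Y ι : Type*} [DecidableEq Y] [Fintype ι]

/-- The weight `h x` of the feature `x` of a labelled point `z = (x, y)`, kept only if `y = c`. -/
def labelWeight (h : X → ℝ) (c : Y) (z : X × Y) : ℝ :=
  (if z.2 = c then 1 else 0) * h z.1

/-- The relative frequency of the label `c` in the labelled sample `w`, where a point with feature
`x` counts with weight `h x`; it is `0` if all weights vanish. With `h = s(·, xᵢ)` and the `i`-th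
point left out of the sample this is `posteriorEstimate`. -/
def labelFrequency (h : X → ℝ) (w : ι → X × Y) (c : Y) : ℝ :=
  (∑ j, labelWeight h c (w j)) / ∑ j, h (w j).1

variable {h : X → ℝ} {b p q : ℝ}

theorem labelWeight_nonneg (hh : ∀ x, 0 ≤ h x) (c : Y) (z : X × Y) : 0 ≤ labelWeight h c z :=
  mul_nonneg (by split_ifs <;> norm_num) (hh _)

theorem labelWeight_le (hh : ∀ x, 0 ≤ h x) (c : Y) (z : X × Y) : labelWeight h c z ≤ h z.1 :=
  mul_le_of_le_one_left (hh _) (by split_ifs <;> norm_num)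

theorem labelWeight_mem_Icc (hb : ∀ x, h x ∈ Set.Icc 0 b) (c : Y) (z : X × Y) :
    labelWeight h c z ∈ Set.Icc 0 b :=
  ⟨labelWeight_nonneg (fun x => (hb x).1) c z,
    (labelWeight_le (fun x => (hb x).1) c z).trans (hb z.1).2⟩

theorem sum_labelWeight [Fintype Y] (h : X → ℝ) (z : X × Y) : ∑ c, labelWeight h c z = h z.1 := by
  simp [labelWeight]

theorem labelFrequency_mem_Icc (hh : ∀ x, 0 ≤ h x) (w : ι → X × Y) (c : Y) :
    labelFrequency h w c ∈ Set.Icc 0 1 :=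
  ⟨div_nonneg (Finset.sum_nonneg fun _ _ => labelWeight_nonneg hh _ _)
      (Finset.sum_nonneg fun _ _ => hh _),
    div_le_one_of_le₀ (Finset.sum_le_sum fun _ _ => labelWeight_le hh _ _)
      (Finset.sum_nonneg fun _ _ => hh _)⟩

theorem mul_abs_div_sub_le {N S : ℝ} (hN : 0 ≤ N) (hNS : N ≤ S) (hp : 0 ≤ p) (q : ℝ) :
    p * |N / S - q| ≤ |N - p * q| + |S - p| := by
  have hratio_nonneg : 0 ≤ N / S := div_nonneg hN (hN.trans hNS)
  have hratio_le : N / S ≤ 1 := div_le_one_of_le₀ hNS (hN.trans hNS)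
  have hcancel : N / S * S = N :=
    div_mul_cancel_of_imp fun hS => le_antisymm (hNS.trans_eq hS) hN
  calc p * |N / S - q| = |(N - p * q) - N / S * (S - p)| := by
        rw [← abs_of_nonneg hp, ← abs_mul, abs_of_nonneg hp, mul_sub, mul_sub, hcancel]
        ring_nf
    _ ≤ |N - p * q| + |N / S * (S - p)| := abs_sub _ _
    _ ≤ |N - p * q| + |S - p| := by
        rw [abs_mul, abs_of_nonneg hratio_nonneg]
        gcongr
        exact mul_le_of_le_one_left (abs_nonneg _) hratio_le

theorem mul_abs_labelFrequency_sub_le [Nonempty ι] (hh : ∀ x, 0 ≤ h x) (hp : 0 ≤ p) (q : ℝ)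
    (w : ι → X × Y) (c : Y) :
    p * |labelFrequency h w c - q| ≤
      |(∑ j, labelWeight h c (w j)) / Fintype.card ι - p * q| +
        |(∑ j, h (w j).1) / Fintype.card ι - p| := by
  have hcard : (Fintype.card ι : ℝ) ≠ 0 := by simp
  rw [labelFrequency, ← div_div_div_cancel_right₀ hcard]
  refine mul_abs_div_sub_le ?_ ?_ hp q
  · exact div_nonneg (Finset.sum_nonneg fun _ _ => labelWeight_nonneg hh _ _) (by positivity)
  · gcongr
    exact labelWeight_le hh _ _

variable [MeasurableSpace X] [MeasurableSpace Y] [MeasurableSingletonClass Y]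

theorem measurable_labelWeight {A : Type*} [MeasurableSpace A] {h : A → X → ℝ} {z : A → X × Y}
    (hh : Measurable (Function.uncurry h)) (hz : Measurable z) (c : Y) :
    Measurable fun a => labelWeight (h a) c (z a) :=
  (Measurable.ite (hz.snd (measurableSet_singleton c)) measurable_const measurable_const).mul
    (hh.comp (measurable_id.prodMk hz.fst))

theorem measurable_labelFrequency {A : Type*} [MeasurableSpace A] {h : A → X → ℝ}
    {w : A → ι → X × Y} (hh : Measurable (Function.uncurry h)) (hw : Measurable w) (c : Y) :
    Measurable fun a => labelFrequency (h a) (w a) c :=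
  (Finset.measurable_sum _ fun j _ =>
      measurable_labelWeight hh ((measurable_pi_apply j).comp hw) c).div
    (Finset.measurable_sum _ fun j _ =>
      hh.comp (measurable_id.prodMk ((measurable_pi_apply j).comp hw).fst))

variable {D : Measure (X × Y)}

theorem integrable_labelWeight [IsFiniteMeasure D] (hh : Measurable h)
    (hb : ∀ x, h x ∈ Set.Icc 0 b) (c : Y) :
    Integrable (labelWeight h c) D :=
  .of_mem_Icc 0 b (measurable_labelWeight (h := fun _ => h) (hh.comp measurable_snd) measurable_id
    c).aemeasurable (.of_forall fun z => labelWeight_mem_Icc hb c z)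

theorem integral_labelWeight_le [IsFiniteMeasure D] (hh : Measurable h)
    (hb : ∀ x, h x ∈ Set.Icc 0 b) (c : Y) :
    ∫ z, labelWeight h c z ∂D ≤ ∫ z, h z.1 ∂D :=
  integral_mono (integrable_labelWeight hh hb c)
    (.of_mem_Icc 0 b (hh.comp measurable_fst).aemeasurable (.of_forall fun z => hb z.1))
    fun z => labelWeight_le (fun x => (hb x).1) c z

variable [IsProbabilityMeasure D]

theorem integrable_labelFrequency (hh : Measurable h) (hh0 : ∀ x, 0 ≤ h x) (c : Y) :
    Integrable (fun w : ι → X × Y => labelFrequency h w c) (Measure.pi fun _ => D) :=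
  .of_mem_Icc 0 1 (measurable_labelFrequency (h := fun _ => h) (hh.comp measurable_snd)
    measurable_id c).aemeasurable (.of_forall fun w => labelFrequency_mem_Icc hh0 w c)

theorem mul_integral_abs_labelFrequency_sub_le [Nonempty ι] (hh : Measurable h)
    (hb : ∀ x, h x ∈ Set.Icc 0 b) (hp : 0 ≤ p) (q : ℝ) (c : Y) :
    p * ∫ w : ι → X × Y, |labelFrequency h w c - q| ∂(Measure.pi fun _ => D) ≤
      |∫ z, labelWeight h c z ∂D - p * q| + |∫ z, h z.1 ∂D - p| +
        2 * √(b * (∫ z, h z.1 ∂D) / Fintype.card ι) := by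
  have hh0 : ∀ x, 0 ≤ h x := fun x => (hb x).1
  have hb0 : 0 ≤ b :=
    let ⟨z⟩ := D.nonempty_of_neZero
    (hb z.1).1.trans (hb z.1).2
  set P : Measure (ι → X × Y) := Measure.pi fun _ => D
  set EN := ∫ z, labelWeight h c z ∂D
  set ES := ∫ z, h z.1 ∂D
  have hN : ∫ w : ι → X × Y, |(∑ j, labelWeight h c (w j)) / Fintype.card ι - EN| ∂P ≤
      √(b * ES / Fintype.card ι) := by
    refine (integral_abs_average_sub_le_sqrt_mul_integral (measurable_labelWeight
      (h := fun _ => h) (hh.comp measurable_snd) measurable_id c)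
      (labelWeight_mem_Icc hb c)).trans (Real.sqrt_le_sqrt ?_)
    gcongr
    exact integral_labelWeight_le hh hb c
  have hS : ∫ w : ι → X × Y, |(∑ j, h (w j).1) / Fintype.card ι - ES| ∂P ≤
      √(b * ES / Fintype.card ι) :=
    integral_abs_average_sub_le_sqrt_mul_integral (hh.comp measurable_fst) fun z => hb z.1
  have hNi := integrable_abs_average_sub (ι := ι) (integrable_labelWeight (D := D) hh hb c) EN
  have hSi := integrable_abs_average_sub (ι := ι) (D := D) (f := fun z => h z.1) (.of_mem_Icc 0 b
    (hh.comp measurable_fst).aemeasurable (.of_forall fun z => hb z.1)) ES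
  calc p * ∫ w, |labelFrequency h w c - q| ∂P
    _ ≤ ∫ w, (|(∑ j, labelWeight h c (w j)) / Fintype.card ι - EN| +
          |(∑ j, h (w j).1) / Fintype.card ι - ES| + (|EN - p * q| + |ES - p|)) ∂P := by
      rw [← integral_const_mul]
      refine integral_mono
        (((integrable_labelFrequency hh hh0 c).sub (integrable_const q)).abs.const_mul p)
        ((hNi.fun_add hSi).fun_add (integrable_const _)) fun w => ?_
      linarith [mul_abs_labelFrequency_sub_le hh0 hp q w c,
        abs_sub_le ((∑ j, labelWeight h c (w j)) / Fintype.card ι) EN (p * q),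
        abs_sub_le ((∑ j, h (w j).1) / Fintype.card ι) ES p]
    _ = ∫ w, |(∑ j, labelWeight h c (w j)) / Fintype.card ι - EN| ∂P +
          ∫ w, |(∑ j, h (w j).1) / Fintype.card ι - ES| ∂P + (|EN - p * q| + |ES - p|) := by
      rw [integral_add (hNi.fun_add hSi) (integrable_const _), integral_add hNi hSi,
        integral_const, probReal_univ, one_smul]
    _ ≤ _ := by linarith

theorem mul_integral_abs_labelFrequency_sub_le_add_sqrt [Nonempty ι] (hh : Measurable h)
    (hb : ∀ x, h x ∈ Set.Icc 0 b) (hp : 0 ≤ p) (hq : q ∈ Set.Icc 0 1) (c : Y) :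
    p * ∫ w : ι → X × Y, |labelFrequency h w c - q| ∂(Measure.pi fun _ => D) ≤
      |∫ z, labelWeight h c z ∂D - p * q| + |∫ z, h z.1 ∂D - p| +
        √(8 * b / Fintype.card ι) * √p := by
  have hb0 : 0 ≤ b :=
    let ⟨z⟩ := D.nonempty_of_neZero
    (hb z.1).1.trans (hb z.1).2
  rcases le_total p |∫ z, h z.1 ∂D - p| with hlarge | hsmall
  · have hle_one : ∫ w : ι → X × Y, |labelFrequency h w c - q| ∂(Measure.pi fun _ => D) ≤ 1 := by
      simpa using integral_mono
        (((integrable_labelFrequency (ι := ι) (D := D) hh (fun x => (hb x).1) c).sub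
          (integrable_const q)).abs) (integrable_const (1 : ℝ)) fun w => by
        have hw := labelFrequency_mem_Icc (fun x => (hb x).1) w c
        exact abs_sub_le_of_nonneg_of_le hw.1 hw.2 hq.1 hq.2
    have hroot : 0 ≤ √(8 * b / Fintype.card ι) * √p := by positivity
    linarith [mul_le_of_le_one_right hp hle_one, abs_nonneg (∫ z, labelWeight h c z ∂D - p * q)]
  · have hmean : ∫ z, h z.1 ∂D ≤ 2 * p := by linarith [le_abs_self (∫ z, h z.1 ∂D - p)]
    have hroot : 2 * √(b * (∫ z, h z.1 ∂D) / Fintype.card ι) ≤ √(8 * b / Fintype.card ι) * √p := by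
      rw [← Real.sqrt_mul (by positivity)]
      refine Real.le_sqrt_of_sq_le ?_
      have hES : 0 ≤ ∫ z, h z.1 ∂D := integral_nonneg fun z => (hb z.1).1
      rw [mul_pow, Real.sq_sqrt (by positivity)]
      calc (2 : ℝ) ^ 2 * (b * (∫ z, h z.1 ∂D) / Fintype.card ι)
        _ ≤ 2 ^ 2 * (b * (2 * p) / Fintype.card ι) := by gcongr
        _ = 8 * b / Fintype.card ι * p := by ring
    linarith [mul_integral_abs_labelFrequency_sub_le (ι := ι) (D := D) hh hb hp q c]

end LabelFrequency

section Posterior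

variable {X Y : Type*} [MeasurableSpace X] [MeasurableSpace Y] [StandardBorelSpace Y] [Nonempty Y]
  (D : Measure (X × Y)) [IsFiniteMeasure D]

theorem posterior_mem_Icc (x : X) (c : Y) : posterior D x c ∈ Set.Icc 0 1 :=
  ⟨measureReal_nonneg, measureReal_le_one⟩

theorem measurable_posterior (c : Y) : Measurable fun x => posterior D x c :=
  (ProbabilityTheory.Kernel.measurable_coe _ (measurableSet_singleton c)).ennreal_toReal

end Posterior

section PosteriorEstimate

variable {X Y : Type*} [DecidableEq Y] {s : X → X → ℝ}

theorem posteriorEstimate_eq_labelFrequency (s : X → X → ℝ) {m : ℕ} (z : Fin (m + 1) → X × Y)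
    (i : Fin (m + 1)) (c : Y) :
    posteriorEstimate s z i c = labelFrequency (fun x => s x (z i).1) (i.removeNth z) c := by
  simp only [posteriorEstimate, labelFrequency, labelWeight, Fin.removeNth,
    Finset.sum_erase_eq_sub (Finset.mem_univ i), Fin.sum_univ_succAbove _ i, add_sub_cancel_left]
  rfl

theorem posteriorEstimate_mem_Icc (hs : ∀ x x', 0 ≤ s x x') {n : ℕ} (z : Fin n → X × Y)
    (i : Fin n) (c : Y) : posteriorEstimate s z i c ∈ Set.Icc 0 1 := by
  obtain ⟨m, rfl⟩ := Nat.exists_eq_add_one.2 i.pos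
  rw [posteriorEstimate_eq_labelFrequency]
  exact labelFrequency_mem_Icc (fun x => hs x _) _ _

variable [MeasurableSpace X] [MeasurableSpace Y]

theorem measurable_posteriorEstimate [MeasurableSingletonClass Y]
    (hs : Measurable (Function.uncurry s)) {n : ℕ} (i : Fin n) (c : Y) :
    Measurable fun z : Fin n → X × Y => posteriorEstimate s z i c := by
  obtain ⟨m, rfl⟩ := Nat.exists_eq_add_one.2 i.pos
  simp_rw [posteriorEstimate_eq_labelFrequency]
  exact measurable_labelFrequency (h := fun (z : Fin (m + 1) → X × Y) x => s x (z i).1)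
    (w := fun z => i.removeNth z)
    (hs.comp (by fun_prop :
      Measurable fun q : (Fin (m + 1) → X × Y) × X => (q.2, (q.1 i).1)))
    (measurable_pi_lambda _ fun j => measurable_pi_apply (i.succAbove j)) c

variable [StandardBorelSpace Y] [Nonempty Y] {D : Measure (X × Y)}

theorem abs_posteriorEstimate_sub_posterior_le_one [IsFiniteMeasure D]
    (hs : ∀ x x', 0 ≤ s x x') {n : ℕ} (z : Fin n → X × Y) (i : Fin n) (c : Y) :
    |posteriorEstimate s z i c - posterior D (z i).1 c| ≤ 1 := by
  have hest := posteriorEstimate_mem_Icc hs z i c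
  have hp := posterior_mem_Icc D (z i).1 c
  exact abs_sub_le_of_nonneg_of_le hest.1 hest.2 hp.1 hp.2

variable [IsProbabilityMeasure D]

theorem integrable_abs_posteriorEstimate_sub (hs : Measurable (Function.uncurry s))
    (hs0 : ∀ x x', 0 ≤ s x x') {n : ℕ} (i : Fin n) (c : Y) :
    Integrable (fun z : Fin n → X × Y => |posteriorEstimate s z i c - posterior D (z i).1 c|)
      (Measure.pi fun _ => D) := by
  have hpost : Measurable fun z : Fin n → X × Y => posterior D (z i).1 c :=
    (measurable_posterior D c).comp (by fun_prop)
  exact .of_mem_Icc 0 1 ((measurable_posteriorEstimate hs i c).sub hpost).abs.aemeasurable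
    (.of_forall fun z =>
      ⟨abs_nonneg _, abs_posteriorEstimate_sub_posterior_le_one hs0 z i c⟩)

theorem integral_abs_posteriorEstimate_sub_le_one (hs : Measurable (Function.uncurry s))
    (hs0 : ∀ x x', 0 ≤ s x x') {n : ℕ} (i : Fin n) (c : Y) :
    ∫ z : Fin n → X × Y, |posteriorEstimate s z i c - posterior D (z i).1 c|
      ∂(Measure.pi fun _ => D) ≤ 1 := by
  simpa using integral_mono (integrable_abs_posteriorEstimate_sub (D := D) hs hs0 i c)
    (integrable_const (1 : ℝ)) fun z => abs_posteriorEstimate_sub_posterior_le_one hs0 z i c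

theorem integral_abs_posteriorEstimate_sub_eq (hs : Measurable (Function.uncurry s))
    (hs0 : ∀ x x', 0 ≤ s x x') {m : ℕ} (i : Fin (m + 1)) (c : Y) :
    ∫ z : Fin (m + 1) → X × Y, |posteriorEstimate s z i c - posterior D (z i).1 c|
        ∂(Measure.pi fun _ => D) =
      ∫ x, ∫ w : Fin m → X × Y, |labelFrequency (fun x' => s x' x) w c - posterior D x c|
        ∂(Measure.pi fun _ => D) ∂D.fst := by
  have hmeas : Measurable fun q : X × (Fin m → X × Y) =>
      |labelFrequency (fun x' => s x' q.1) q.2 c - posterior D q.1 c| :=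
    ((measurable_labelFrequency (h := fun (q : X × (Fin m → X × Y)) x' => s x' q.1)
      (w := fun q => q.2) (hs.comp (by fun_prop :
        Measurable fun r : (X × (Fin m → X × Y)) × X => (r.2, r.1.1))) measurable_snd c).sub
      ((measurable_posterior D c).comp measurable_fst)).abs
  have hint : Integrable (Function.uncurry fun (a : X × Y) (w : Fin m → X × Y) =>
      |labelFrequency (fun x' => s x' a.1) w c - posterior D a.1 c|)
      (D.prod (Measure.pi fun _ => D)) := by
    refine .of_mem_Icc 0 1 (hmeas.comp (by fun_prop : Measurable fun q : (X × Y) ×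
      (Fin m → X × Y) => (q.1.1, q.2))).aemeasurable (.of_forall fun q => ⟨abs_nonneg _, ?_⟩)
    have hest := labelFrequency_mem_Icc (fun x' => hs0 x' q.1.1) q.2 c
    have hp := posterior_mem_Icc D q.1.1 c
    exact abs_sub_le_of_nonneg_of_le hest.1 hest.2 hp.1 hp.2
  rw [Measure.fst, integral_map measurable_fst.aemeasurable
    hmeas.stronglyMeasurable.integral_prod_right'.aestronglyMeasurable]
  simp_rw [posteriorEstimate_eq_labelFrequency]
  exact integral_pi_removeNth i hint

end PosteriorEstimate

section JointDensity

variable {X Y : Type*} [MeasurableSpace X] [MeasurableSpace Y]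

/-- `g c` is the joint density `p(x, y = c)` of `D` with respect to the reference measure `ν` in the
feature and the counting measure in the label: the part of `IsRegularDensity` on which the analysis
of a general similarity function rests. -/
structure IsJointDensity (D : Measure (X × Y)) (ν : Measure X) (g : Y → X → ℝ) : Prop where
  measurable : ∀ c, Measurable (g c)
  nonneg : ∀ c x, 0 ≤ g c x
  density : ∀ c (A : Set X), MeasurableSet A → D (A ×ˢ {c}) = ∫⁻ x in A, ENNReal.ofReal (g c x) ∂ν

/-- The error `∫ s(x', x) f(x') dν(x') - f(x)` made by smoothing `f` with the similarity `s`. -/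
def smoothingBias (ν : Measure X) (s : X → X → ℝ) (f : X → ℝ) (x : X) : ℝ :=
  (∫ x', s x' x * f x' ∂ν) - f x

namespace IsJointDensity

variable {D : Measure (X × Y)} {ν : Measure X} {g : Y → X → ℝ}

theorem integrable [IsFiniteMeasure D] (hg : IsJointDensity D ν g) (c : Y) :
    Integrable (g c) ν := by
  refine ⟨(hg.measurable c).aestronglyMeasurable,
    (hasFiniteIntegral_iff_ofReal (.of_forall (hg.nonneg c))).2 ?_⟩
  rw [← setLIntegral_univ, ← hg.density c _ MeasurableSet.univ]
  exact measure_lt_top _ _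

theorem map_fst_restrict (hg : IsJointDensity D ν g) (c : Y) :
    (D.restrict (Prod.snd ⁻¹' {c})).map Prod.fst =
      ν.withDensity fun x => ENNReal.ofReal (g c x) := by
  ext A hA
  rw [Measure.map_apply measurable_fst hA, Measure.restrict_apply (measurable_fst hA),
    withDensity_apply _ hA, ← hg.density c A hA, Set.prod_eq]

theorem integral_labelWeight [DecidableEq Y] [MeasurableSingletonClass Y]
    (hg : IsJointDensity D ν g) (c : Y) {h : X → ℝ} (hh : Measurable h) :
    ∫ z, labelWeight h c z ∂D = ∫ x, h x * g c x ∂ν := by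
  have hlabel : MeasurableSet (Prod.snd ⁻¹' {c} : Set (X × Y)) :=
    measurable_snd (measurableSet_singleton c)
  calc ∫ z, labelWeight h c z ∂D
    _ = ∫ z, (Prod.snd ⁻¹' {c}).indicator (fun z => h z.1) z ∂D := by
      refine integral_congr_ae (.of_forall fun z => ?_)
      by_cases hz : z.2 = c <;> simp [labelWeight, hz]
    _ = ∫ x, h x ∂((D.restrict (Prod.snd ⁻¹' {c})).map Prod.fst) := by
      rw [integral_indicator hlabel, integral_map measurable_fst.aemeasurable
        hh.aestronglyMeasurable]
    _ = ∫ x, h x * g c x ∂ν := by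
      rw [hg.map_fst_restrict, integral_withDensity_eq_integral_toReal_smul
        (hg.measurable c).ennreal_ofReal (.of_forall fun _ => ENNReal.ofReal_lt_top)]
      simp [ENNReal.toReal_ofReal (hg.nonneg c _), mul_comm]

variable [Fintype Y]

theorem marginal_nonneg (hg : IsJointDensity D ν g) (x : X) : 0 ≤ ∑ c, g c x :=
  Finset.sum_nonneg fun c _ => hg.nonneg c x

theorem measurable_marginal (hg : IsJointDensity D ν g) : Measurable fun x => ∑ c, g c x :=
  Finset.measurable_sum _ fun c _ => hg.measurable c

variable [MeasurableSingletonClass Y]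

theorem fst_eq_withDensity (hg : IsJointDensity D ν g) :
    D.fst = ν.withDensity fun x => ENNReal.ofReal (∑ c, g c x) := by
  ext A hA
  have hfibres : Prod.fst ⁻¹' A = ⋃ c ∈ (Finset.univ : Finset Y), A ×ˢ ({c} : Set Y) := by
    ext z
    simp
  rw [Measure.fst_apply hA, withDensity_apply _ hA, hfibres, measure_biUnion_finset]
  · simp_rw [ENNReal.ofReal_sum_of_nonneg fun c _ => hg.nonneg c _, hg.density _ A hA]
    rw [lintegral_finsetSum _ fun c _ => (hg.measurable c).ennreal_ofReal]
  · exact fun c _ c' _ hne => Set.disjoint_left.2 fun z hz hz' => hne (hz.2.symm.trans hz'.2)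
  · exact fun c _ => hA.prod (measurableSet_singleton c)

theorem integral_fst (hg : IsJointDensity D ν g) (h : X → ℝ) :
    ∫ x, h x ∂D.fst = ∫ x, (∑ c, g c x) * h x ∂ν := by
  rw [hg.fst_eq_withDensity, integral_withDensity_eq_integral_toReal_smul
    hg.measurable_marginal.ennreal_ofReal (.of_forall fun _ => ENNReal.ofReal_lt_top)]
  simp [ENNReal.toReal_ofReal (hg.marginal_nonneg _)]

variable [SigmaFinite ν] [Nonempty Y]

theorem marginal_mul_posterior [IsFiniteMeasure D] (hg : IsJointDensity D ν g) (c : Y) :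
    ∀ᵐ x ∂ν, (∑ c', g c' x) * posterior D x c = g c x := by
  have hcond : Measurable fun x => D.condKernel x {c} :=
    ProbabilityTheory.Kernel.measurable_coe _ (measurableSet_singleton c)
  have hp := hg.measurable_marginal.ennreal_ofReal
  have hdisintegration : (fun x => ENNReal.ofReal (∑ c', g c' x) * D.condKernel x {c}) =ᵐ[ν]
      fun x => ENNReal.ofReal (g c x) := by
    refine ae_eq_of_forall_setLIntegral_eq_of_sigmaFinite (hp.mul hcond)
      (hg.measurable c).ennreal_ofReal fun A hA _ => ?_
    rw [← hg.density c A hA,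
      ← Measure.setLIntegral_condKernel_eq_measure_prod hA (measurableSet_singleton c),
      hg.fst_eq_withDensity, setLIntegral_withDensity_eq_setLIntegral_mul _ hp hcond hA]
    simp
  filter_upwards [hdisintegration] with x hx
  have := congrArg ENNReal.toReal hx
  rwa [ENNReal.toReal_mul, ENNReal.toReal_ofReal (hg.marginal_nonneg x),
    ENNReal.toReal_ofReal (hg.nonneg c x)] at this

variable [DecidableEq Y] [IsProbabilityMeasure D] {s : X → X → ℝ} {b : ℝ}

theorem marginal_mul_integral_abs_labelFrequency_sub_le {ι : Type*} [Fintype ι] [Nonempty ι]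
    (hg : IsJointDensity D ν g) (hs : Measurable (Function.uncurry s))
    (hb : ∀ x x', s x x' ∈ Set.Icc 0 b) (c : Y) :
    ∀ᵐ x ∂ν, (∑ c', g c' x) * ∫ w : ι → X × Y,
        |labelFrequency (fun x' => s x' x) w c - posterior D x c| ∂(Measure.pi fun _ => D) ≤
      2 * ∑ c', |smoothingBias ν s (g c') x| +
        √(8 * b / Fintype.card ι) * √(∑ c', g c' x) := by
  filter_upwards [hg.marginal_mul_posterior c] with x hx
  have hh : Measurable fun x' => s x' x := hs.comp measurable_prodMk_right
  have hbias : ∀ c', ∫ z, labelWeight (fun x' => s x' x) c' z ∂D - g c' x =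
      smoothingBias ν s (g c') x := fun c' => by
    rw [hg.integral_labelWeight c' hh, smoothingBias]
  have hbias_marginal : ∫ z : X × Y, s z.1 x ∂D - ∑ c', g c' x =
      ∑ c', smoothingBias ν s (g c') x := by
    simp_rw [← hbias, Finset.sum_sub_distrib]
    rw [← integral_finsetSum _ fun c' _ => integrable_labelWeight hh (fun x' => hb x' x) c']
    simp_rw [sum_labelWeight]
  have hle := mul_integral_abs_labelFrequency_sub_le_add_sqrt (ι := ι) (D := D) hh
    (fun x' => hb x' x) (hg.marginal_nonneg x) (posterior_mem_Icc D x c) c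
  rw [hx, hbias, hbias_marginal] at hle
  linarith [Finset.abs_sum_le_sum_abs (fun c' => smoothingBias ν s (g c') x) Finset.univ,
    Finset.single_le_sum (fun c' _ => abs_nonneg (smoothingBias ν s (g c') x))
      (Finset.mem_univ c)]

theorem integral_abs_posteriorEstimate_sub_le (hg : IsJointDensity D ν g)
    (hs : Measurable (Function.uncurry s)) (hb : ∀ x x', s x x' ∈ Set.Icc 0 b)
    (hbias : ∀ c, Integrable (smoothingBias ν s (g c)) ν)
    (hsqrt : Integrable (fun x => √(∑ c, g c x)) ν) {m : ℕ} (hm : 0 < m) (i : Fin (m + 1))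
    (c : Y) :
    ∫ z : Fin (m + 1) → X × Y, |posteriorEstimate s z i c - posterior D (z i).1 c|
        ∂(Measure.pi fun _ => D) ≤
      2 * ∑ c', ∫ x, |smoothingBias ν s (g c') x| ∂ν +
        √(8 * b / m) * ∫ x, √(∑ c', g c' x) ∂ν := by
  have : Nonempty (Fin m) := ⟨⟨0, hm⟩⟩
  have hbias_sum : Integrable (fun x => 2 * ∑ c', |smoothingBias ν s (g c') x|) ν :=
    (integrable_finsetSum _ fun c' _ => (hbias c').abs).const_mul 2
  have hroot : Integrable (fun x => √(8 * b / m) * √(∑ c', g c' x)) ν := hsqrt.const_mul _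
  rw [integral_abs_posteriorEstimate_sub_eq hs (fun x x' => (hb x x').1), hg.integral_fst]
  calc ∫ x, (∑ c', g c' x) * ∫ w : Fin m → X × Y,
        |labelFrequency (fun x' => s x' x) w c - posterior D x c| ∂(Measure.pi fun _ => D) ∂ν
    _ ≤ ∫ x, (2 * ∑ c', |smoothingBias ν s (g c') x| + √(8 * b / m) * √(∑ c', g c' x)) ∂ν := by
      refine integral_mono_of_nonneg (.of_forall fun x => mul_nonneg (hg.marginal_nonneg x)
        (integral_nonneg fun _ => abs_nonneg _)) (hbias_sum.fun_add hroot) ?_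
      filter_upwards [hg.marginal_mul_integral_abs_labelFrequency_sub_le (ι := Fin m) hs hb c]
        with x hx
      rwa [Fintype.card_fin] at hx
    _ = 2 * ∑ c', ∫ x, |smoothingBias ν s (g c') x| ∂ν +
          √(8 * b / m) * ∫ x, √(∑ c', g c' x) ∂ν := by
      rw [integral_add hbias_sum hroot, integral_const_mul, integral_const_mul,
        integral_finsetSum _ fun c' _ => (hbias c').abs]

end IsJointDensity

end JointDensity

section SmoothingKernel

variable {d : ℕ} {Y : Type*}

/-- The kernel `K_σ(u) = σ⁻ᵈ K(u / σ)`, so that `similarity K σ x x' = K_σ(x - x')`. -/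
def scaledKernel (K : EuclideanSpace ℝ (Fin d) → ℝ) (σ : ℝ) (u : EuclideanSpace ℝ (Fin d)) : ℝ :=
  (σ ^ d)⁻¹ * K (σ⁻¹ • u)

theorem integral_mul_scaledKernel (K : EuclideanSpace ℝ (Fin d) → ℝ) {σ : ℝ} (hσ : 0 < σ)
    (f : EuclideanSpace ℝ (Fin d) → ℝ) :
    ∫ u, f u * scaledKernel K σ u = ∫ u, f (σ • u) * K u := by
  have hsubst := Measure.integral_comp_inv_smul_of_nonneg volume
    (fun u : EuclideanSpace ℝ (Fin d) => (σ ^ d)⁻¹ * (f (σ • u) * K u)) hσ.le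
  simp only [smul_inv_smul₀ hσ.ne', finrank_euclideanSpace, Fintype.card_fin, smul_eq_mul,
    integral_const_mul] at hsubst
  rw [mul_inv_cancel_left₀ (by positivity)] at hsubst
  rw [← hsubst, ← integral_const_mul]
  exact integral_congr_ae (.of_forall fun u => mul_left_comm _ _ _)

theorem integral_norm_sq_mul_scaledKernel (K : EuclideanSpace ℝ (Fin d) → ℝ) {σ : ℝ} (hσ : 0 < σ) :
    ∫ u, ‖u‖ ^ 2 * scaledKernel K σ u = σ ^ 2 * ∫ u, ‖u‖ ^ 2 * K u := by
  rw [integral_mul_scaledKernel K hσ, ← integral_const_mul]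
  simp_rw [norm_smul, mul_pow, Real.norm_of_nonneg hσ.le, mul_assoc]

namespace IsSmoothingKernel

variable {K : EuclideanSpace ℝ (Fin d) → ℝ} {σ : ℝ}

theorem integrable (hK : IsSmoothingKernel K) : Integrable K :=
  integrable_of_integral_eq_one hK.integral_eq_one

theorem rescale (hK : IsSmoothingKernel K) (hσ : 0 < σ) : IsSmoothingKernel (scaledKernel K σ) where
  measurable := (hK.measurable.comp (by fun_prop)).const_mul _
  nonneg u := mul_nonneg (by positivity) (hK.nonneg _)
  even u := by simp only [scaledKernel, smul_neg, hK.even]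
  bounded := by
    obtain ⟨κ, hκ⟩ := hK.bounded
    exact ⟨(σ ^ d)⁻¹ * κ, fun u => mul_le_mul_of_nonneg_left (hκ _) (by positivity)⟩
  integral_eq_one := by
    simpa only [one_mul, hK.integral_eq_one] using integral_mul_scaledKernel K hσ fun _ => 1
  second_moment := by
    have hsubst := (hK.second_moment.comp_smul (inv_ne_zero hσ.ne')).const_mul
      (σ ^ 2 * (σ ^ d)⁻¹)
    refine hsubst.congr (.of_forall fun u => ?_)
    simp only [scaledKernel, norm_smul, Real.norm_of_nonneg (inv_nonneg.2 hσ.le)]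
    field_simp

theorem measurable_similarity (hK : IsSmoothingKernel K) (σ : ℝ) :
    Measurable (Function.uncurry (similarity K σ)) :=
  (hK.measurable.comp (by fun_prop : Measurable fun q : EuclideanSpace ℝ (Fin d) ×
    EuclideanSpace ℝ (Fin d) => σ⁻¹ • (q.1 - q.2))).const_mul _

theorem similarity_nonneg (hK : IsSmoothingKernel K) (hσ : 0 < σ)
    (x x' : EuclideanSpace ℝ (Fin d)) : 0 ≤ similarity K σ x x' :=
  (hK.rescale hσ).nonneg (x - x')

open scoped Convolution
open ContinuousLinearMap (lsmul)

theorem smoothingBias_similarity (hK : IsSmoothingKernel K) (hσ : 0 < σ)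
    (f : EuclideanSpace ℝ (Fin d) → ℝ) (x : EuclideanSpace ℝ (Fin d)) :
    smoothingBias volume (similarity K σ) f x =
      (scaledKernel K σ ⋆[lsmul ℝ ℝ, volume] f) x - f x := by
  rw [smoothingBias, convolution_lsmul_swap]
  simp_rw [← neg_sub _ x, (hK.rescale hσ).even]
  rfl

variable {f : EuclideanSpace ℝ (Fin d) → ℝ}

theorem integrable_smoothingBias (hK : IsSmoothingKernel K) (hσ : 0 < σ) (hf : Integrable f) :
    Integrable (smoothingBias volume (similarity K σ) f) := by
  rw [funext (hK.smoothingBias_similarity hσ f)]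
  exact ((hK.rescale hσ).integrable.integrable_convolution (lsmul ℝ ℝ) hf).sub hf

theorem integral_abs_smoothingBias_le (hK : IsSmoothingKernel K) (hσ : 0 < σ)
    (hf : Integrable f) (hf2 : ContDiff ℝ 2 f) (hfH : Integrable (iteratedFDeriv ℝ 2 f)) :
    ∫ x, |smoothingBias volume (similarity K σ) f x| ≤
      σ ^ 2 * ((∫ u, ‖u‖ ^ 2 * K u) * ∫ x, ‖iteratedFDeriv ℝ 2 f x‖) := by
  have hKσ := hK.rescale hσ
  have hnorm : ∀ u, ‖scaledKernel K σ u‖ = scaledKernel K σ u := fun u =>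
    Real.norm_of_nonneg (hKσ.nonneg u)
  have hbias := integral_norm_convolution_sub_le hKσ.integrable hKσ.even hKσ.integral_eq_one
    (by simpa only [hnorm] using hKσ.second_moment) hf hf2 hfH
  simp_rw [hnorm, integral_norm_sq_mul_scaledKernel K hσ, mul_assoc] at hbias
  simpa only [hK.smoothingBias_similarity hσ f, Real.norm_eq_abs] using hbias

end IsSmoothingKernel

variable [Fintype Y] [MeasurableSpace Y] {D : Measure (EuclideanSpace ℝ (Fin d) × Y)}
  {g : Y → EuclideanSpace ℝ (Fin d) → ℝ} {K : EuclideanSpace ℝ (Fin d) → ℝ} {σ : ℝ}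

theorem IsRegularDensity.isJointDensity (hg : IsRegularDensity D g) :
    IsJointDensity D volume g :=
  ⟨fun c => (hg.contDiff c).continuous.measurable, hg.nonneg, hg.density⟩

variable [Nonempty Y] [DecidableEq Y] [MeasurableSingletonClass Y] [IsProbabilityMeasure D]

theorem IsRegularDensity.integral_abs_posteriorEstimate_sub_le (hg : IsRegularDensity D g)
    (hK : IsSmoothingKernel K) {κ : ℝ} (hκ : ∀ u, K u ≤ κ) (hσ : 0 < σ) {m : ℕ} (hm : 0 < m)
    (i : Fin (m + 1)) (c : Y) :
    ∫ z : Fin (m + 1) → EuclideanSpace ℝ (Fin d) × Y,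
        |posteriorEstimate (similarity K σ) z i c - posterior D (z i).1 c|
          ∂(Measure.pi fun _ => D) ≤
      2 * ((∫ u, ‖u‖ ^ 2 * K u) * ∑ c', ∫ x, ‖iteratedFDeriv ℝ 2 (g c') x‖) * σ ^ 2 +
        √(8 * κ / (m * σ ^ d)) * ∫ x, √(∑ c', g c' x) := by
  have hgD := hg.isJointDensity
  have hb : ∀ x x', similarity K σ x x' ∈ Set.Icc 0 ((σ ^ d)⁻¹ * κ) := fun x x' =>
    ⟨hK.similarity_nonneg hσ x x', mul_le_mul_of_nonneg_left (hκ _) (by positivity)⟩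
  have hbias : ∑ c', ∫ x, |smoothingBias volume (similarity K σ) (g c') x| ≤
      (∫ u, ‖u‖ ^ 2 * K u) * (∑ c', ∫ x, ‖iteratedFDeriv ℝ 2 (g c') x‖) * σ ^ 2 := by
    rw [mul_comm, Finset.mul_sum, Finset.mul_sum]
    exact Finset.sum_le_sum fun c' _ => hK.integral_abs_smoothingBias_le hσ (hgD.integrable c')
      (hg.contDiff c') (hg.integrable_hessian c')
  have hle := hgD.integral_abs_posteriorEstimate_sub_le (hK.measurable_similarity σ) hb
    (fun c' => hK.integrable_smoothingBias hσ (hgD.integrable c')) hg.integrable_sqrt hm i c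
  rw [show 8 * ((σ ^ d)⁻¹ * κ) / m = 8 * κ / (m * σ ^ d) by field_simp] at hle
  linarith

end SmoothingKernel

section BayesErrorEstimate

theorem iSup_mem_Icc_of_forall {Y : Type*} [Nonempty Y] {u : Y → ℝ} {a b : ℝ}
    (hu : ∀ c, u c ∈ Set.Icc a b) : ⨆ c, u c ∈ Set.Icc a b :=
  let ⟨c⟩ := ‹Nonempty Y›
  ⟨(hu c).1.trans (le_ciSup ⟨b, Set.forall_mem_range.2 fun c => (hu c).2⟩ c),
    ciSup_le fun c => (hu c).2⟩

theorem abs_iSup_sub_iSup_le_sum {Y : Type*} [Fintype Y] [Nonempty Y] (u v : Y → ℝ) :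
    |(⨆ c, u c) - ⨆ c, v c| ≤ ∑ c, |u c - v c| := by
  have hone_sided : ∀ u v : Y → ℝ, (⨆ c, u c) - ⨆ c, v c ≤ ∑ c, |u c - v c| := fun u v => by
    rw [sub_le_iff_le_add]
    refine ciSup_le fun c => ?_
    linarith [le_ciSup (Finite.bddAbove_range v) c, le_abs_self (u c - v c),
      Finset.single_le_sum (fun c _ => abs_nonneg (u c - v c)) (Finset.mem_univ c)]
  refine abs_sub_le_iff.2 ⟨hone_sided u v, ?_⟩
  simpa only [abs_sub_comm] using hone_sided v u

theorem bayesErrorEstimate_mem_Icc {X Y : Type*} [Nonempty Y] [DecidableEq Y] {s : X → X → ℝ}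
    (hs0 : ∀ x x', 0 ≤ s x x') {n : ℕ} (z : Fin n → X × Y) :
    bayesErrorEstimate s z ∈ Set.Icc 0 1 := by
  have hmax : ∀ i, ⨆ c, posteriorEstimate s z i c ∈ Set.Icc 0 1 := fun i =>
    iSup_mem_Icc_of_forall fun c => posteriorEstimate_mem_Icc hs0 z i c
  have hsum_le : ∑ i, ⨆ c, posteriorEstimate s z i c ≤ n := by
    simpa using Finset.sum_le_card_nsmul Finset.univ _ 1 fun i _ => (hmax i).2
  rw [bayesErrorEstimate, one_div_mul_eq_div]
  exact ⟨sub_nonneg.2 (div_le_one_of_le₀ hsum_le n.cast_nonneg),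
    sub_le_self _ (div_nonneg (Finset.sum_nonneg fun i _ => (hmax i).1) n.cast_nonneg)⟩

variable {X Y : Type*} [MeasurableSpace X] [MeasurableSpace Y]

section Posterior

variable [Nonempty Y] [StandardBorelSpace Y] (D : Measure (X × Y))

theorem iSup_posterior_mem_Icc [IsFiniteMeasure D] (x : X) :
    ⨆ c, posterior D x c ∈ Set.Icc 0 1 :=
  iSup_mem_Icc_of_forall fun c => posterior_mem_Icc D x c

variable [Countable Y]

theorem measurable_iSup_posterior [IsFiniteMeasure D] :
    Measurable fun x => ⨆ c, posterior D x c :=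
  .iSup fun c => measurable_posterior D c

theorem integrable_iSup_posterior [IsFiniteMeasure D] :
    Integrable (fun z : X × Y => ⨆ c, posterior D z.1 c) D :=
  .of_mem_Icc 0 1 ((measurable_iSup_posterior D).comp measurable_fst).aemeasurable
    (.of_forall fun z => iSup_posterior_mem_Icc D z.1)

variable [IsProbabilityMeasure D]

theorem bayesError_eq : bayesError D = 1 - ∫ z : X × Y, ⨆ c, posterior D z.1 c ∂D := by
  rw [bayesError, Measure.fst, integral_map measurable_fst.aemeasurable
    ((measurable_iSup_posterior D).const_sub 1).aestronglyMeasurable,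
    integral_sub (integrable_const (μ := D) 1) (integrable_iSup_posterior D)]
  simp

theorem integral_abs_average_iSup_posterior_sub_le {n : ℕ} (hn : 1 ≤ n) :
    ∫ z : Fin n → X × Y, |(∑ i, ⨆ c, posterior D (z i).1 c) / n -
        ∫ z, ⨆ c, posterior D z.1 c ∂D| ∂(Measure.pi fun _ => D) ≤ 1 / √n := by
  have : Nonempty (Fin n) := ⟨⟨0, hn⟩⟩
  have hroot := integral_abs_average_sub_le_sqrt_mul_integral (ι := Fin n) (D := D)
    ((measurable_iSup_posterior D).comp measurable_fst) fun z => iSup_posterior_mem_Icc D z.1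
  have hmean : ∫ z, ⨆ c, posterior D z.1 c ∂D ≤ 1 := by
    simpa using integral_mono (integrable_iSup_posterior D) (integrable_const (1 : ℝ))
      fun z => (iSup_posterior_mem_Icc D z.1).2
  simp only [Function.comp_apply, Fintype.card_fin, one_mul] at hroot
  refine hroot.trans ?_
  rw [← Real.sqrt_one, ← Real.sqrt_div zero_le_one]
  gcongr

end Posterior

section Estimate

variable [DecidableEq Y] {s : X → X → ℝ}

theorem measurable_bayesErrorEstimate [Countable Y] [MeasurableSingletonClass Y]
    (hs : Measurable (Function.uncurry s)) (n : ℕ) :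
    Measurable fun z : Fin n → X × Y => bayesErrorEstimate s z :=
  ((Finset.measurable_sum _ fun i _ =>
    .iSup fun c => measurable_posteriorEstimate hs i c).const_mul _).const_sub _

theorem integrable_abs_bayesErrorEstimate_sub [Countable Y] [Nonempty Y]
    [MeasurableSingletonClass Y] {D : Measure (X × Y)} [IsProbabilityMeasure D]
    (hs : Measurable (Function.uncurry s)) (hs0 : ∀ x x', 0 ≤ s x x') (n : ℕ) (β : ℝ) :
    Integrable (fun z : Fin n → X × Y => |bayesErrorEstimate s z - β|)
      (Measure.pi fun _ => D) :=
  ((Integrable.of_mem_Icc 0 1 (measurable_bayesErrorEstimate hs n).aemeasurable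
    (.of_forall fun z => bayesErrorEstimate_mem_Icc hs0 z)).sub (integrable_const β)).abs

end Estimate

variable [Fintype Y] [Nonempty Y] [DecidableEq Y] [MeasurableSingletonClass Y]
  {D : Measure (X × Y)} [IsProbabilityMeasure D] {s : X → X → ℝ}

theorem abs_bayesErrorEstimate_sub_le {n : ℕ} (z : Fin n → X × Y) :
    |bayesErrorEstimate s z - bayesError D| ≤
      1 / n * ∑ i, ∑ c, |posteriorEstimate s z i c - posterior D (z i).1 c| +
        |(∑ i, ⨆ c, posterior D (z i).1 c) / n - ∫ z, ⨆ c, posterior D z.1 c ∂D| := by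
  have hsplit : bayesErrorEstimate s z - bayesError D =
      -(1 / n * ∑ i, ((⨆ c, posteriorEstimate s z i c) - ⨆ c, posterior D (z i).1 c)) -
        ((∑ i, ⨆ c, posterior D (z i).1 c) / n - ∫ z, ⨆ c, posterior D z.1 c ∂D) := by
    rw [bayesError_eq, bayesErrorEstimate, Finset.sum_sub_distrib]
    ring
  rw [hsplit]
  refine (abs_sub _ _).trans (add_le_add_left ?_ _)
  rw [abs_neg, abs_mul, abs_of_nonneg (by positivity)]
  gcongr
  exact (Finset.abs_sum_le_sum_abs _ _).trans
    (Finset.sum_le_sum fun i _ => abs_iSup_sub_iSup_le_sum _ _)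

theorem integral_abs_bayesErrorEstimate_sub_le (hs : Measurable (Function.uncurry s))
    (hs0 : ∀ x x', 0 ≤ s x x') {n : ℕ} (hn : 1 ≤ n) {ε : ℝ}
    (hε : ∀ (i : Fin n) (c : Y), ∫ z : Fin n → X × Y,
      |posteriorEstimate s z i c - posterior D (z i).1 c| ∂(Measure.pi fun _ => D) ≤ ε) :
    ∫ z : Fin n → X × Y, |bayesErrorEstimate s z - bayesError D| ∂(Measure.pi fun _ => D) ≤
      Fintype.card Y * ε + 1 / √n := by
  have hpost := fun (i : Fin n) (c : Y) =>
    integrable_abs_posteriorEstimate_sub (D := D) hs hs0 i c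
  have hsum := (integrable_finsetSum Finset.univ fun (i : Fin n) _ =>
    integrable_finsetSum Finset.univ fun (c : Y) _ => hpost i c).const_mul (1 / (n : ℝ))
  have havg := integrable_abs_average_sub (ι := Fin n) (integrable_iSup_posterior D)
    (∫ z, ⨆ c, posterior D z.1 c ∂D)
  rw [Fintype.card_fin] at havg
  calc ∫ z : Fin n → X × Y, |bayesErrorEstimate s z - bayesError D| ∂(Measure.pi fun _ => D)
    _ ≤ ∫ z : Fin n → X × Y,
          (1 / n * ∑ i, ∑ c, |posteriorEstimate s z i c - posterior D (z i).1 c| +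
            |(∑ i, ⨆ c, posterior D (z i).1 c) / n - ∫ z, ⨆ c, posterior D z.1 c ∂D|)
          ∂(Measure.pi fun _ => D) :=
      integral_mono (integrable_abs_bayesErrorEstimate_sub hs hs0 n _) (hsum.fun_add havg)
        fun z => abs_bayesErrorEstimate_sub_le z
    _ = 1 / n * ∑ i, ∑ c, ∫ z : Fin n → X × Y,
            |posteriorEstimate s z i c - posterior D (z i).1 c| ∂(Measure.pi fun _ => D) +
          ∫ z : Fin n → X × Y, |(∑ i, ⨆ c, posterior D (z i).1 c) / n -
            ∫ z, ⨆ c, posterior D z.1 c ∂D| ∂(Measure.pi fun _ => D) := by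
      rw [integral_add hsum havg, integral_const_mul,
        integral_finsetSum _ fun i _ => integrable_finsetSum _ fun c _ => hpost i c]
      simp_rw [integral_finsetSum Finset.univ fun c _ => hpost _ c]
    _ ≤ 1 / n * ∑ _i : Fin n, ∑ _c : Y, ε + 1 / √n := by
      gcongr
      · exact hε _ _
      · exact integral_abs_average_iSup_posterior_sub_le D hn
    _ = Fintype.card Y * ε + 1 / √n := by
      have : (n : ℝ) ≠ 0 := by positivity
      simp only [Finset.sum_const, Finset.card_univ, Fintype.card_fin, nsmul_eq_mul]
      field_simp

end BayesErrorEstimate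

section Rate

theorem one_div_sqrt_le_rate {C₁ C₂ : ℝ} (h₁ : 1 ≤ C₁) (h₂ : 1 ≤ C₂) {n : ℕ} (hn : 1 ≤ n)
    {σ : ℝ} (hσ : 0 < σ) (d : ℕ) : 1 / √n ≤ C₂ * σ ^ 2 + C₁ / √(n * σ ^ d) := by
  have hn' : (1 : ℝ) ≤ n := by exact_mod_cast hn
  rcases le_total σ 1 with hσ1 | hσ1
  · have hle : √(n * σ ^ d) ≤ √n :=
      Real.sqrt_le_sqrt (mul_le_of_le_one_right (by positivity) (pow_le_one₀ hσ.le hσ1))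
    calc 1 / √n
      _ ≤ C₁ / √(n * σ ^ d) := by gcongr
      _ ≤ C₂ * σ ^ 2 + C₁ / √(n * σ ^ d) := le_add_of_nonneg_left (by positivity)
  · calc 1 / √n
      _ ≤ 1 := div_le_one_of_le₀ (Real.one_le_sqrt.2 hn') (Real.sqrt_nonneg _)
      _ ≤ C₂ * σ ^ 2 := one_le_mul_of_one_le_of_one_le h₂ (one_le_pow₀ hσ1)
      _ ≤ C₂ * σ ^ 2 + C₁ / √(n * σ ^ d) := le_add_of_nonneg_right (by positivity)

theorem IsRegularDensity.exists_integral_abs_posteriorEstimate_sub_le {d : ℕ} {Y : Type*}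
    [Fintype Y] [Nonempty Y] [DecidableEq Y] [MeasurableSpace Y] [MeasurableSingletonClass Y]
    {D : Measure (EuclideanSpace ℝ (Fin d) × Y)} [IsProbabilityMeasure D]
    {g : Y → EuclideanSpace ℝ (Fin d) → ℝ} (hg : IsRegularDensity D g)
    {K : EuclideanSpace ℝ (Fin d) → ℝ} (hK : IsSmoothingKernel K) :
    ∃ C₁ C₂ : ℝ, 1 ≤ C₁ ∧ 1 ≤ C₂ ∧ ∀ n : ℕ, 1 ≤ n → ∀ σ : ℝ, 0 < σ → ∀ (i : Fin n) (c : Y),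
      ∫ z : Fin n → EuclideanSpace ℝ (Fin d) × Y,
        |posteriorEstimate (similarity K σ) z i c - posterior D (z i).1 c|
          ∂(Measure.pi fun _ => D) ≤ C₂ * σ ^ 2 + C₁ / √(n * σ ^ d) := by
  obtain ⟨κ, hκ⟩ := hK.bounded
  have hκ0 : 0 ≤ κ := (hK.nonneg 0).trans (hκ 0)
  set R := ∫ x, √(∑ c, g c x)
  set M := (∫ u, ‖u‖ ^ 2 * K u) * ∑ c, ∫ x, ‖iteratedFDeriv ℝ 2 (g c) x‖
  have hM : 0 ≤ M := mul_nonneg (integral_nonneg fun u => mul_nonneg (sq_nonneg _) (hK.nonneg u))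
    (Finset.sum_nonneg fun c _ => integral_nonneg fun _ => norm_nonneg _)
  have hC₁ : 1 ≤ 1 + √(16 * κ) * R := le_add_of_nonneg_right (by positivity)
  have hC₂ : 1 ≤ 1 + 2 * M := le_add_of_nonneg_right (by positivity)
  refine ⟨1 + √(16 * κ) * R, 1 + 2 * M, hC₁, hC₂, fun n hn σ hσ i c => ?_⟩
  obtain ⟨m, rfl⟩ := Nat.exists_eq_add_one.2 hn
  rcases m.eq_zero_or_pos with rfl | hm
  · simpa using (integral_abs_posteriorEstimate_sub_le_one (D := D) (hK.measurable_similarity σ)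
      (hK.similarity_nonneg hσ) i c).trans
      (by simpa using one_div_sqrt_le_rate hC₁ hC₂ hn hσ d)
  have hroot : √(8 * κ / (m * σ ^ d)) ≤ √(16 * κ) / √((m + 1 : ℕ) * σ ^ d) := by
    rw [← Real.sqrt_div (by positivity)]
    refine Real.sqrt_le_sqrt ?_
    have hm' : (m + 1 : ℝ) ≤ 2 * m := by exact_mod_cast (by omega : m + 1 ≤ 2 * m)
    calc 8 * κ / (m * σ ^ d) = 16 * κ / (2 * m * σ ^ d) := by ring
      _ ≤ 16 * κ / ((m + 1 : ℕ) * σ ^ d) := by push_cast; gcongr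
  calc _ ≤ 2 * M * σ ^ 2 + √(8 * κ / (m * σ ^ d)) * R :=
        hg.integral_abs_posteriorEstimate_sub_le hK hκ hσ hm i c
    _ ≤ 2 * M * σ ^ 2 + √(16 * κ) / √((m + 1 : ℕ) * σ ^ d) * R := by gcongr
    _ = 2 * M * σ ^ 2 + √(16 * κ) * R / √((m + 1 : ℕ) * σ ^ d) := by ring
    _ ≤ (1 + 2 * M) * σ ^ 2 + (1 + √(16 * κ) * R) / √((m + 1 : ℕ) * σ ^ d) := by
        gcongr <;> linarith

end Rate

end BayesError

end

theorem mainTheorem1 {d : ℕ} {Y : Type*} [Fintype Y] [Nonempty Y] [DecidableEq Y]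
    [MeasurableSpace Y] [MeasurableSingletonClass Y]
    (D : Measure (EuclideanSpace ℝ (Fin d) × Y)) [IsProbabilityMeasure D]
    (g : Y → EuclideanSpace ℝ (Fin d) → ℝ) (hg : BayesError.IsRegularDensity D g)
    (K : EuclideanSpace ℝ (Fin d) → ℝ) (hK : BayesError.IsSmoothingKernel K) :
    ∃ C₁ C₂ : ℝ, 0 < C₁ ∧ 0 < C₂ ∧
      ∀ n : ℕ, 1 ≤ n → ∀ σ : ℝ, 0 < σ →
        (∀ (i : Fin n) (c : Y),
          Integrable (fun z : Fin n → EuclideanSpace ℝ (Fin d) × Y =>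
            |BayesError.posteriorEstimate (BayesError.similarity K σ) z i c
              - BayesError.posterior D (z i).1 c|) (Measure.pi fun _ => D) ∧
          ∫ z : Fin n → EuclideanSpace ℝ (Fin d) × Y,
            |BayesError.posteriorEstimate (BayesError.similarity K σ) z i c
              - BayesError.posterior D (z i).1 c| ∂(Measure.pi fun _ => D)
            ≤ C₂ * σ ^ 2 + C₁ / √(n * σ ^ d)) ∧
        (Integrable (fun z : Fin n → EuclideanSpace ℝ (Fin d) × Y =>
            |BayesError.bayesErrorEstimate (BayesError.similarity K σ) z
              - BayesError.bayesError D|) (Measure.pi fun _ => D) ∧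
          ∫ z : Fin n → EuclideanSpace ℝ (Fin d) × Y,
            |BayesError.bayesErrorEstimate (BayesError.similarity K σ) z
              - BayesError.bayesError D| ∂(Measure.pi fun _ => D)
            ≤ 2 * C₂ * Fintype.card Y * σ ^ 2
              + 2 * C₁ * Fintype.card Y / √(n * σ ^ d)) := by
  obtain ⟨C₁, C₂, h₁, h₂, hC⟩ := hg.exists_integral_abs_posteriorEstimate_sub_le hK
  refine ⟨C₁, C₂, by linarith, by linarith, fun n hn σ hσ => ?_⟩
  have hs := hK.measurable_similarity σ
  have hs0 := hK.similarity_nonneg hσ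
  refine ⟨fun i c => ⟨BayesError.integrable_abs_posteriorEstimate_sub hs hs0 i c,
    hC n hn σ hσ i c⟩, BayesError.integrable_abs_bayesErrorEstimate_sub hs hs0 n _, ?_⟩
  have hrate := BayesError.one_div_sqrt_le_rate h₁ h₂ hn hσ d
  have hcard : (1 : ℝ) ≤ Fintype.card Y := by exact_mod_cast Fintype.card_pos
  set ε := C₂ * σ ^ 2 + C₁ / √(n * σ ^ d)
  have hε : 0 ≤ ε := le_trans (by positivity) hrate
  calc _ ≤ Fintype.card Y * ε + 1 / √n :=
        BayesError.integral_abs_bayesErrorEstimate_sub_le hs hs0 hn (hC n hn σ hσ)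
    _ ≤ Fintype.card Y * ε + Fintype.card Y * ε := by
        gcongr
        exact hrate.trans (le_mul_of_one_le_left hε hcard)
    _ = 2 * C₂ * Fintype.card Y * σ ^ 2 + 2 * C₁ * Fintype.card Y / √(n * σ ^ d) := by ring
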